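/- Let $X$ be a real Banach space whose dual space $X^*$, with the dual norm, is rotund (strictly convex). For a nonempty closed set $K\subseteq X$ put $$d_K(x)=\inf\{\|x-k\| : k\in K\},\qquad P_K(x)=\{k\in K : \|x-k\|=d_K(x)\};$$ the elements of $P_K(x)$ are the closest points to $x$ in $K$. The set $K$ is called almost proximinal if $\{x\in X\setminus K : P_K(x)\neq\emptyset\}$ is dense in $X\setminus K$. An almost proximinal set $K$ is called an almost sun if there is a dense set of points $x\in X\setminus K$ each of which has a closest point $p\in P_K(x)$ such that $$p\in P_K\!\left(x+t\,\frac{x-p}{\|x-p\|}\right)\qquad\text{for all } t\ge 0.$$ Theorem. Every nonempty closed set $K\subseteq X$ that is an almost sun is convex. -/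

import Mathlib

/-- The metric projection `P_K(x) = {k ∈ K : ‖x - k‖ = d_K(x)}`, where
`d_K(x) = inf {‖x - k‖ : k ∈ K}` is the distance function of `K`. -/
def metricProjection {X : Type*} [NormedAddCommGroup X] (K : Set X) (x : X) : Set X :=
  {k | k ∈ K ∧ ‖x - k‖ = Metric.infDist x K}

/-- `K` is almost proximinal if the points outside `K` that have a closest point in `K` are
dense in the complement of `K`. -/
def IsAlmostProximinal {X : Type*} [NormedAddCommGroup X] (K : Set X) : Prop :=
  Kᶜ ⊆ closure {x | x ∈ Kᶜ ∧ (metricProjection K x).Nonempty}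

/-- `p` is a closest point in `K` to `x`, and it remains a closest point to every point `x + t u`,
`t ≥ 0`, where `u` is the unit vector in the direction of `x - p`. -/
def IsSolarPoint {X : Type*} [NormedAddCommGroup X] [NormedSpace ℝ X]
    (K : Set X) (x p : X) : Prop :=
  p ∈ metricProjection K x ∧
    ∀ t : ℝ, 0 ≤ t → p ∈ metricProjection K (x + t • (‖x - p‖⁻¹ • (x - p)))

/-- `K` is an almost sun if it is almost proximinal and the points outside `K` that have a
closest point `p` in `K` which stays closest along the whole ray from `x` in the direction
`x - p` are dense in the complement of `K`. -/
def IsAlmostSun {X : Type*} [NormedAddCommGroup X] [NormedSpace ℝ X] (K : Set X) : Prop :=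
  IsAlmostProximinal K ∧ Kᶜ ⊆ closure {x | x ∈ Kᶜ ∧ ∃ p, IsSolarPoint K x p}

/-! Along a solar ray from `p` in direction `u`, growing balls missing `K` fill an open convex cone
at `p`. Rotundity of the dual makes the norming functional `f` of `u` unique, so `K` lies in `{f ≤ f
p}`, while `f x - f p = d_K(x)`. A convex combination `z ∉ K` of points of `K` also has `f z ≤ f p`;
hence `d_K(x) ≤ ‖x - z‖` for solar `x` arbitrarily near `z`, contradicting `d_K(z) > 0`. -/

/-- In a normed space with strictly convex dual, a point that avoids every ball `ball (s • u) s`,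
`s > 0`, lies in the half-space `{f ≤ 0}` of any norming functional `f` of the unit vector `u`. -/
theorem apply_nonpos_of_forall_le_norm_sub_smul {X : Type*} [NormedAddCommGroup X]
    [NormedSpace ℝ X] [StrictConvexSpace ℝ (StrongDual ℝ X)] {u w : X} {f : StrongDual ℝ X}
    (hu : ‖u‖ = 1) (hf : ‖f‖ = 1) (hfu : f u = 1) (hw : ∀ s : ℝ, 0 < s → s ≤ ‖w - s • u‖) :
    f w ≤ 0 := by
  let U : Set X := {v | ∃ s : ℝ, 0 < s ∧ ‖v - s • u‖ < s}
  have hconv : Convex ℝ U := by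
    rw [convex_iff_forall_pos]
    rintro v ⟨s, hs, hv⟩ v' ⟨t, ht, hv'⟩ a b ha hb -
    refine ⟨a * s + b * t, by positivity, ?_⟩
    calc ‖a • v + b • v' - (a * s + b * t) • u‖
        = ‖a • (v - s • u) + b • (v' - t • u)‖ := by congr 1; module
      _ ≤ a * ‖v - s • u‖ + b * ‖v' - t • u‖ := by
        refine (norm_add_le _ _).trans_eq ?_
        rw [norm_smul_of_nonneg ha.le, norm_smul_of_nonneg hb.le]
      _ < a * s + b * t := by gcongr
  have hopen : IsOpen U := by
    have : U = ⋃ s ∈ Set.Ioi (0 : ℝ), Metric.ball (s • u) s := by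
      ext v; simp [U, dist_eq_norm]
    rw [this]
    exact isOpen_biUnion fun s _ => Metric.isOpen_ball
  have hwU : w ∉ U := fun ⟨s, hs, h⟩ => (hw s hs).not_gt h
  obtain ⟨g, hg⟩ := geometric_hahn_banach_open_point hconv hopen hwU
  have hcone : ∀ v ∈ U, ∀ c : ℝ, 0 < c → c • v ∈ U := by
    rintro v ⟨s, hs, hv⟩ c hc
    refine ⟨c * s, by positivity, ?_⟩
    rw [mul_smul, ← smul_sub, norm_smul_of_nonneg hc.le]
    gcongr
  have hgU : ∀ v ∈ U, g v ≤ 0 := by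
    intro v hv
    by_contra! h
    -- Rescaled so that `g` takes the value `|g w| + 1 > g w`.
    have := hg _ (hcone v hv ((|g w| + 1) / g v) (by positivity))
    rw [map_smul, smul_eq_mul, div_mul_cancel₀ _ h.ne'] at this
    linarith [le_abs_self (g w)]
  have huU : u ∈ U := ⟨1, one_pos, by simp⟩
  have hgw : 0 ≤ g w := by
    by_contra! h
    have h1 : g u < 0 := (hg u huU).trans h
    have := hg _ (hcone u huU (g w / g u) (div_pos_of_neg_of_neg h h1))
    rw [map_smul, smul_eq_mul, div_mul_cancel₀ _ h1.ne] at this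
    exact this.false
  have hbound : ∀ v, g v ≤ -g u * ‖v‖ := by
    intro v
    have hc : ∀ c, ‖v‖ < c → g v ≤ -g u * c := by
      intro c hc
      have := hgU (v + c • u) ⟨c, (norm_nonneg v).trans_lt hc, by simpa using hc⟩
      rw [map_add, map_smul, smul_eq_mul] at this
      linarith
    have hcont : Continuous fun c : ℝ => -g u * c := by fun_prop
    exact ge_of_tendsto (hcont.continuousWithinAt (s := Set.Ioi ‖v‖) (x := ‖v‖))
      (eventually_mem_nhdsWithin.mono hc)
  have hnorm : ‖g‖ ≤ -g u := by
    refine g.opNorm_le_bound (by linarith [hgU u huU]) fun v => ?_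
    rw [Real.norm_eq_abs, abs_le]
    have := hbound (-v)
    rw [map_neg, norm_neg] at this
    exact ⟨by linarith, hbound v⟩
  have hg0 : -g ≠ 0 := by
    intro h
    have := hg u huU
    simp [neg_eq_zero.mp h] at this
  -- Both `f` and `-g` attain their norm at `u`, so their norms add; strict convexity then aligns
  -- them.
  have hray : SameRay ℝ f (-g) := by
    refine sameRay_iff_norm_add.mpr (le_antisymm (norm_add_le _ _) ?_)
    have h := (f + -g).le_opNorm u
    rw [hu, mul_one] at h
    have h' := (le_abs_self _).trans h
    simp only [add_apply, neg_apply, hfu] at h'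
    rw [hf, norm_neg]
    linarith
  have hf0 : f ≠ 0 := by rintro rfl; simp at hf
  obtain ⟨c, hc, hcf⟩ := hray.exists_pos_right hf0 hg0
  rw [hcf, smul_apply, neg_apply, smul_eq_mul]
  nlinarith

/-- In a normed space with strictly convex dual, a point outside `K` with a solar point `p` is
separated from `K` by a unit functional whose gap is the distance of the point to `K`. -/
theorem IsSolarPoint.exists_separating {X : Type*} [NormedAddCommGroup X] [NormedSpace ℝ X]
    [StrictConvexSpace ℝ (StrongDual ℝ X)] {K : Set X} {x p : X} (hx : x ∉ K)
    (h : IsSolarPoint K x p) :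
    ∃ f : StrongDual ℝ X, ‖f‖ = 1 ∧ f x - f p = Metric.infDist x K ∧ ∀ y ∈ K, f y ≤ f p := by
  obtain ⟨⟨hpK, hxp⟩, hray⟩ := h
  have hne : x - p ≠ 0 := sub_ne_zero.mpr fun h => hx (h ▸ hpK)
  have hr : 0 < ‖x - p‖ := norm_pos_iff.mpr hne
  obtain ⟨f, hf, hfx⟩ := exists_dual_vector ℝ (x - p) hr.ne'
  replace hfx : f (x - p) = ‖x - p‖ := hfx
  refine ⟨f, hf, by rw [← map_sub, hfx, hxp], fun y hy => ?_⟩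
  set u := ‖x - p‖⁻¹ • (x - p) with hu
  have hu1 : ‖u‖ = 1 := by
    rw [hu, norm_smul, norm_inv, norm_norm, inv_mul_cancel₀ hr.ne']
  have hxu : x = p + ‖x - p‖ • u := by
    rw [hu, smul_inv_smul₀ hr.ne', add_sub_cancel]
  rw [← sub_nonpos, ← map_sub]
  refine apply_nonpos_of_forall_le_norm_sub_smul hu1 hf ?_ fun s hs => ?_
  · rw [hu, map_smul, hfx, smul_eq_mul, inv_mul_cancel₀ hr.ne']
  · have hz : x + s • u = p + (‖x - p‖ + s) • u := by
      rw [add_smul, ← add_assoc, ← hxu]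
    have hdist := (hray s hs.le).2
    rw [hz, add_sub_cancel_left, norm_smul_of_nonneg (by positivity), hu1, mul_one] at hdist
    have hle : ‖x - p‖ + s ≤ ‖y - p - (‖x - p‖ + s) • u‖ := by
      refine hdist.le.trans ((Metric.infDist_le_dist_of_mem hy).trans_eq ?_)
      rw [dist_comm, dist_eq_norm, sub_sub]
    -- The ball of radius `s` at `p + s • u` lies in the one of radius `‖x - p‖ + s` further along
    -- the ray, so radii below `‖x - p‖` are covered too.
    have htri : ‖y - p - (‖x - p‖ + s) • u‖ ≤ ‖y - p - s • u‖ + ‖x - p‖ := by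
      calc ‖y - p - (‖x - p‖ + s) • u‖ = ‖y - p - s • u - ‖x - p‖ • u‖ := by congr 1; module
        _ ≤ ‖y - p - s • u‖ + ‖‖x - p‖ • u‖ := norm_sub_le _ _
        _ = _ := by rw [norm_smul_of_nonneg hr.le, hu1, mul_one]
    linarith

theorem mainTheorem1 {X : Type*} [NormedAddCommGroup X] [NormedSpace ℝ X] [CompleteSpace X]
    [StrictConvexSpace ℝ (StrongDual ℝ X)]
    (K : Set X) (hne : K.Nonempty) (hclosed : IsClosed K) (hsun : IsAlmostSun K) :
    Convex ℝ K := by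
  intro a ha b hb α β hα hβ hαβ
  by_contra hz
  set z := α • a + β • b with hzdef
  have hd : 0 < Metric.infDist z K := (hclosed.notMem_iff_infDist_pos hne).mp hz
  obtain ⟨x, ⟨hx, p, hp⟩, hzx⟩ :=
    Metric.mem_closure_iff.mp (hsun.2 hz) (Metric.infDist z K / 2) (by positivity)
  obtain ⟨f, hf, hfx, hfK⟩ := hp.exists_separating hx
  have hdx : Metric.infDist z K ≤ Metric.infDist x K + dist z x :=
    Metric.infDist_le_infDist_add_dist
  have hfz : f x - f z ≤ dist z x := by
    rw [← map_sub, dist_comm, dist_eq_norm]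
    exact (le_abs_self _).trans (by simpa [hf] using f.le_opNorm (x - z))
  have hzp : f z ≤ f p := by
    have : f z = α * f a + β * f b := by simp [hzdef]
    rw [this]
    calc α * f a + β * f b ≤ α * f p + β * f p := by
          gcongr
          exacts [hfK a ha, hfK b hb]
      _ = f p := by rw [← add_mul, hαβ, one_mul]
  linarith
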